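/- Let $k$ be a field and let $\Lambda$ be a finite dimensional selfinjective $k$-algebra on which a finite group $G$ acts by $k$-algebra automorphisms, and suppose that the order of $G$ is invertible in $k$. Let $\Lambda[G]$ be the skew group algebra, i.e. the vector space $\Lambda\otimes_k kG$ with multiplication $(\lambda\otimes g)(\lambda'\otimes g')=\lambda\, g(\lambda')\otimes gg'$. For a finite dimensional algebra $A$ let $\operatorname{mod} A$ be the category of finitely generated left $A$-modules; a module in $\operatorname{mod} A$ is a generator (respectively a cogenerator) if every indecomposable projective (respectively injective) module in $\operatorname{mod} A$ is isomorphic to a direct summand of it. The representation dimension of $A$ is $$\operatorname{repdim} A=\inf\{\operatorname{gldim}\operatorname{End}_A(N)\mid N\in\operatorname{mod}A \text{ is a generator and a cogenerator}\},$$ where $\operatorname{gldim}$ denotes global dimension. Let $M$ be a generator in $\operatorname{mod}\Lambda$. For $g\in G$ let ${}_gM$ be $M$ with the scalar multiplication $\lambda\cdot m=g(\lambda)m$, and suppose that $\bigoplus_{g\in G}{}_gM$ belongs to $\operatorname{add}_\Lambda M$, i.e. is isomorphic to a direct summand of a finite direct sum of copies of $M$. Then $$\operatorname{repdim}\Lambda[G]\le\operatorname{gldim}\operatorname{End}_\Lambda(M).$$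 -/

import Mathlib

universe u v w

open scoped DirectSum

/-- The (left) global dimension of a ring: the supremum of the projective dimensions of its left
modules. It takes values in `WithBot ℕ∞`; the value `⊥` occurs only for the zero ring. -/
noncomputable def globalDim (R : Type u) [Ring R] : WithBot ℕ∞ :=
  ⨆ N : ModuleCat.{u} R, CategoryTheory.projectiveDimension N

/-- `X` is isomorphic to a direct summand of `Y`. -/
def IsSummandOf (R : Type u) [Ring R] (X : Type v) [AddCommGroup X] [Module R X]
    (Y : Type w) [AddCommGroup Y] [Module R Y] : Prop :=
  ∃ (i : X →ₗ[R] Y) (p : Y →ₗ[R] X), p ∘ₗ i = LinearMap.id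

/-- `X` belongs to `add M`: it is isomorphic to a direct summand of a finite direct sum of copies
of `M`. -/
def MemAdd (R : Type u) [Ring R] (M : Type v) [AddCommGroup M] [Module R M]
    (X : Type w) [AddCommGroup X] [Module R X] : Prop :=
  ∃ n : ℕ, IsSummandOf R X (Fin n → M)

/-- A nonzero module that is not the direct sum of two nonzero submodules. -/
def IsIndecomposableModule (R : Type u) [Ring R] (X : Type v) [AddCommGroup X] [Module R X] :
    Prop :=
  Nontrivial X ∧ ∀ p q : Submodule R X, IsCompl p q → p = ⊥ ∨ q = ⊥

/-- `M` is a generator of `mod R`: every finitely generated indecomposable projective module is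
isomorphic to a direct summand of `M`. -/
def GeneratesMod (R : Type u) [Ring R] (M : Type v) [AddCommGroup M] [Module R M] : Prop :=
  ∀ P : ModuleCat.{u} R, Module.Finite R P → Module.Projective R P →
    IsIndecomposableModule R P → IsSummandOf R P M

/-- `M` is a cogenerator of `mod R`: every finitely generated indecomposable injective module is
isomorphic to a direct summand of `M`. -/
def CogeneratesMod (R : Type u) [Ring R] (M : Type v) [AddCommGroup M] [Module R M] : Prop :=
  ∀ I : ModuleCat.{u} R, Module.Finite R I → Module.Injective R I →
    IsIndecomposableModule R I → IsSummandOf R I M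

/-- The representation dimension: the infimum of the global dimensions of `End_R(M)`, over all
finitely generated modules `M` that generate and cogenerate `mod R`. -/
noncomputable def repDim (R : Type u) [Ring R] : WithBot ℕ∞ :=
  sInf {d | ∃ M : ModuleCat.{u} R, Module.Finite R M ∧ GeneratesMod R M ∧ CogeneratesMod R M ∧
    d = globalDim (Module.End R M)}

/-- The underlying additive group of the twisted module `_g M`. -/
def TwistedModule {G : Type u} (_g : G) (M : Type v) : Type v := M

instance {G : Type u} (g : G) (M : Type v) [AddCommGroup M] : AddCommGroup (TwistedModule g M) :=
  inferInstanceAs (AddCommGroup M)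

/-- The module `_g M`: the group `M` with scalar multiplication `a · m = g(a) m`. -/
instance {G : Type u} [Group G] (g : G) (A : Type w) [Ring A] [MulSemiringAction G A]
    (M : Type v) [AddCommGroup M] [Module A M] : Module A (TwistedModule g M) :=
  Module.compHom M (MulSemiringAction.toRingHom G A g)

/-
The extension `Λ ⊂ Λ[G]` is a Frobenius extension with dual bases `g⁻¹` and `g`, whose index `|G|`
is invertible. Averaging over the dual bases then makes it separable, so that restriction reflects
projectivity and does not lower projective dimensions: a Frobenius extension of invertible index
does not raise the global dimension. Coinduction is both right and left adjoint to restriction; if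
the coinduced module of `M` lies in `add M`, it follows that `End_Λ(M) → End_Λ[G](Coind M)` is again
a Frobenius extension of the same index, whence `gldim End(Coind M) ≤ gldim End(M)`. By separability
`Coind M` is a generator, and it is also a cogenerator because `Λ[G]` inherits selfinjectivity from
`Λ`.
-/

section FiniteLength

variable {R : Type u} [Ring R]

theorem IsSummandOf.trans {X : Type*} [AddCommGroup X] [Module R X] {Y : Type*} [AddCommGroup Y]
    [Module R Y] {Z : Type*} [AddCommGroup Z] [Module R Z]
    (h : IsSummandOf R X Y) (h' : IsSummandOf R Y Z) : IsSummandOf R X Z := by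
  obtain ⟨i, p, hp⟩ := h
  obtain ⟨j, q, hq⟩ := h'
  refine ⟨j ∘ₗ i, p ∘ₗ q, LinearMap.ext fun x => ?_⟩
  have h1 : q (j (i x)) = i x := LinearMap.congr_fun hq (i x)
  have h2 : p (i x) = x := LinearMap.congr_fun hp x
  simp [h1, h2]

theorem IsSummandOf.of_linearEquiv {X : Type*} [AddCommGroup X] [Module R X] {Y : Type*}
    [AddCommGroup Y] [Module R Y] (e : X ≃ₗ[R] Y) : IsSummandOf R X Y :=
  ⟨e, e.symm, LinearMap.ext fun x => by simp⟩

theorem IsSummandOf.injective {X : Type v} {Y : Type w} [AddCommGroup X] [Module R X]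
    [AddCommGroup Y] [Module R Y] [Small.{w} R] (h : IsSummandOf R X Y)
    (hY : Module.Injective R Y) : Module.Injective R X := by
  obtain ⟨i, p, hp⟩ := h
  refine Module.Baer.injective fun I f => ?_
  obtain ⟨g, hg⟩ := Module.Baer.of_injective hY I (i ∘ₗ f)
  exact ⟨p ∘ₗ g, fun x hx => by simpa [hg x hx] using LinearMap.congr_fun hp (f ⟨x, hx⟩)⟩

theorem IsSummandOf.projective {X : Type v} {Y : Type w} [AddCommGroup X] [Module R X]
    [AddCommGroup Y] [Module R Y] [Module.Projective R Y] (h : IsSummandOf R X Y) :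
    Module.Projective R X :=
  let ⟨i, p, hp⟩ := h
  Module.Projective.of_split i p hp

theorem IsSummandOf.finite {X : Type v} {Y : Type w} [AddCommGroup X] [Module R X]
    [AddCommGroup Y] [Module R Y] [Module.Finite R Y] (h : IsSummandOf R X Y) :
    Module.Finite R X :=
  let ⟨i, p, hp⟩ := h
  Module.Finite.of_surjective p fun x => ⟨i x, LinearMap.congr_fun hp x⟩

theorem sum_apply_single_of_comp_eq_id {X : Type*} [AddCommGroup X] [Module R X] {ι : Type*}
    [Fintype ι] [DecidableEq ι] {Y : ι → Type*} [∀ j, AddCommGroup (Y j)] [∀ j, Module R (Y j)]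
    {i : X →ₗ[R] ∀ j, Y j} {p : (∀ j, Y j) →ₗ[R] X} (h : p ∘ₗ i = LinearMap.id) (x : X) :
    ∑ j, p (Pi.single j (i x j)) = x := by
  rw [← map_sum, Finset.univ_sum_single]
  exact LinearMap.congr_fun h x

theorem isSummandOf_pi_apply {ι : Type*} (Y : ι → Type*) [∀ j, AddCommGroup (Y j)]
    [∀ j, Module R (Y j)] (j : ι) : IsSummandOf R (Y j) (∀ j, Y j) := by
  classical
  exact ⟨LinearMap.single R Y j, LinearMap.proj j, LinearMap.proj_comp_single_same R Y j⟩

theorem IsIndecomposableModule.isLocalRing_end {X : Type*} [AddCommGroup X] [Module R X]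
    [IsArtinian R X] [IsNoetherian R X] (hX : IsIndecomposableModule R X) :
    IsLocalRing (Module.End R X) := by
  have := hX.1
  refine .of_isUnit_or_isUnit_one_sub_self fun f => ?_
  obtain ⟨n, hn, hn0⟩ :=
    (f.eventually_isCompl_ker_pow_range_pow.and (Filter.eventually_ne_atTop 0)).exists
  obtain hker | hrange := hX.2 _ _ hn
  · have hf : Function.Injective (f ^ n) := LinearMap.ker_eq_bot.1 hker
    refine .inl ((isUnit_pow_iff hn0).1 ((Module.End.isUnit_iff _).2 ?_))
    exact IsArtinian.bijective_of_injective_endomorphism _ hf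
  · exact .inr (IsNilpotent.isUnit_one_sub ⟨n, LinearMap.range_eq_bot.1 hrange⟩)

section LocalEnd

variable {X : Type*} [AddCommGroup X] [Module R X] [IsLocalRing (Module.End R X)]

theorem exists_isSummandOf_of_pi {ι : Type*} [Finite ι] {Y : ι → Type*}
    [∀ i, AddCommGroup (Y i)] [∀ i, Module R (Y i)] (h : IsSummandOf R X (∀ i, Y i)) :
    ∃ i, IsSummandOf R X (Y i) := by
  classical
  have := Fintype.ofFinite ι
  obtain ⟨i, p, hp⟩ := h
  let f (j : ι) : Module.End R X := (p ∘ₗ LinearMap.single R Y j) ∘ₗ (LinearMap.proj j ∘ₗ i)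
  have sum_f : ∑ j, f j = 1 := by
    ext x
    simpa [f] using sum_apply_single_of_comp_eq_id hp x
  obtain ⟨j, -, c, hc⟩ := IsLocalRing.exists_of_isUnit_sum (sum_f ▸ isUnit_one)
  refine ⟨j, LinearMap.proj j ∘ₗ i, (↑c⁻¹ : Module.End R X) ∘ₗ (p ∘ₗ LinearMap.single R Y j), ?_⟩
  exact (congrArg ((↑c⁻¹ : Module.End R X) * ·) hc.symm).trans c.inv_mul

theorem bijective_of_apply_eq_self {f : Module.End R X} {x : X} (hx : x ≠ 0) (hf : f x = x) :
    Function.Bijective f := by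
  refine (Module.End.isUnit_iff f).1 ((IsLocalRing.isUnit_or_isUnit_of_add_one
    (add_sub_cancel f 1)).resolve_right fun h => ?_)
  have h0 : (1 - f) x = 0 := by simp [hf]
  exact hx (((Module.End.isUnit_iff _).1 h).1 (h0.trans (map_zero _).symm))

theorem bijective_of_comp_eq {Y : Type*} [AddCommGroup Y] [Module R Y] {f : Module.End R X}
    {g : X →ₗ[R] Y} (hg : g ≠ 0) (hf : ∀ x, g (f x) = g x) : Function.Bijective f := by
  refine (Module.End.isUnit_iff f).1 ((IsLocalRing.isUnit_or_isUnit_of_add_one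
    (add_sub_cancel f 1)).resolve_right fun h => ?_)
  refine hg (LinearMap.ext fun x => ?_)
  obtain ⟨y, rfl⟩ := ((Module.End.isUnit_iff _).1 h).2 x
  simp [hf]

theorem nonempty_linearEquiv_of_projective [Module.Projective R X] {S T : Type*}
    [AddCommGroup S] [Module R S] [AddCommGroup T] [Module R T] [IsSimpleModule R S]
    [IsSimpleModule R T] {f : X →ₗ[R] S} (hf : Function.Surjective f)
    {g : X →ₗ[R] T} (hg : Function.Surjective g) :
    Nonempty (S ≃ₗ[R] T) := by
  have := IsSimpleModule.nontrivial R S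
  have := IsSimpleModule.nontrivial R T
  suffices hker : LinearMap.ker f = LinearMap.ker g from
    ⟨(f.quotKerEquivOfSurjective hf).symm ≪≫ₗ Submodule.quotEquivOfEq _ _ hker ≪≫ₗ
      g.quotKerEquivOfSurjective hg⟩
  suffices hle : LinearMap.ker g ≤ LinearMap.ker f from
    (((LinearMap.isCoatom_ker_of_surjective hg).le_iff_eq
      (LinearMap.isCoatom_ker_of_surjective hf).1).1 hle)
  -- Otherwise `f` lifts through `ker g`, which gives a bijection of `X` with image in `ker g`.
  by_contra hle
  have hne : f.domRestrict (LinearMap.ker g) ≠ 0 := fun h0 =>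
    hle fun x hx => LinearMap.congr_fun h0 ⟨x, hx⟩
  obtain ⟨e, he⟩ := Module.projective_lifting_property _ f (LinearMap.surjective_of_ne_zero hne)
  have e_surj := (bijective_of_comp_eq (f := (LinearMap.ker g).subtype ∘ₗ e)
    (LinearMap.ne_zero_of_surjective hf) (LinearMap.congr_fun he)).2
  refine LinearMap.ne_zero_of_surjective hg (LinearMap.ext fun x => ?_)
  obtain ⟨y, rfl⟩ := e_surj x
  exact (e y).2

end LocalEnd

theorem nonempty_linearEquiv_of_injective {X Y : Type v} {S : Type*} [Small.{v} R]
    [AddCommGroup X] [Module R X] [AddCommGroup Y] [Module R Y] [AddCommGroup S] [Module R S]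
    [IsLocalRing (Module.End R X)] [IsLocalRing (Module.End R Y)] [Nontrivial S]
    (hX : Module.Injective R X) (hY : Module.Injective R Y) {i : S →ₗ[R] X}
    (hi : Function.Injective i) {j : S →ₗ[R] Y} (hj : Function.Injective j) :
    Nonempty (X ≃ₗ[R] Y) := by
  obtain ⟨f, hf⟩ := (Module.Baer.of_injective hY).extension_property i hi j
  obtain ⟨g, hg⟩ := (Module.Baer.of_injective hX).extension_property j hj i
  obtain ⟨s, hs⟩ := exists_ne (0 : S)
  have hfi : f (i s) = j s := LinearMap.congr_fun hf s
  have hgj : g (j s) = i s := LinearMap.congr_fun hg s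
  have hgf : Function.Bijective (g ∘ₗ f) :=
    bijective_of_apply_eq_self ((map_ne_zero_iff i hi).2 hs) (by simp [hfi, hgj])
  have hfg : Function.Bijective (f ∘ₗ g) :=
    bijective_of_apply_eq_self ((map_ne_zero_iff j hj).2 hs) (by simp [hfi, hgj])
  exact ⟨.ofBijective f ⟨.of_comp (f := g) hgf.1, .of_comp (g := g) hfg.2⟩⟩

section Decomposition

variable (R) in
/-- `X` is a finite direct sum of indecomposable modules. -/
def IsFiniteSumOfIndecomposables (X : Type v) [AddCommGroup X] [Module R X] : Prop :=
  ∃ (ι : Type) (_ : Finite ι) (Q : ι → ModuleCat.{v} R),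
    (∀ i, IsIndecomposableModule R (Q i)) ∧ Nonempty (X ≃ₗ[R] ∀ i, Q i)

namespace IsFiniteSumOfIndecomposables

variable {X Y : Type v} [AddCommGroup X] [Module R X] [AddCommGroup Y] [Module R Y]

theorem of_linearEquiv (e : X ≃ₗ[R] Y) (hY : IsFiniteSumOfIndecomposables R Y) :
    IsFiniteSumOfIndecomposables R X :=
  let ⟨ι, hι, Q, hQ, ⟨e'⟩⟩ := hY
  ⟨ι, hι, Q, hQ, ⟨e ≪≫ₗ e'⟩⟩

theorem of_isIndecomposableModule (hX : IsIndecomposableModule R X) :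
    IsFiniteSumOfIndecomposables R X :=
  ⟨Unit, inferInstance, fun _ => ModuleCat.of R X, fun _ => hX,
    ⟨(LinearEquiv.funUnique Unit R X).symm⟩⟩

theorem of_subsingleton [Subsingleton X] : IsFiniteSumOfIndecomposables R X :=
  ⟨Empty, inferInstance, Empty.elim, nofun, ⟨0⟩⟩

theorem prod (hX : IsFiniteSumOfIndecomposables R X) (hY : IsFiniteSumOfIndecomposables R Y) :
    IsFiniteSumOfIndecomposables R (X × Y) := by
  obtain ⟨ι, hι, Q, hQ, ⟨e⟩⟩ := hX
  obtain ⟨κ, hκ, Q', hQ', ⟨e'⟩⟩ := hY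
  exact ⟨ι ⊕ κ, inferInstance, Sum.elim Q Q', Sum.rec hQ hQ',
    ⟨e.prodCongr e' ≪≫ₗ
      (LinearEquiv.sumPiEquivProdPi R ι κ fun i => (Sum.elim Q Q' i : ModuleCat R)).symm⟩⟩

theorem of_isArtinian [IsArtinian R X] : IsFiniteSumOfIndecomposables R X := by
  suffices h : ∀ p : Submodule R X, IsFiniteSumOfIndecomposables R p from
    (h ⊤).of_linearEquiv Submodule.topEquiv.symm
  intro p
  induction p using WellFoundedLT.induction with | ind p ih => ?_
  by_cases hp : IsIndecomposableModule R p
  · exact of_isIndecomposableModule hp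
  obtain _ | _ := subsingleton_or_nontrivial p
  · exact of_subsingleton
  obtain ⟨a, b, hab, ha, hb⟩ : ∃ a b : Submodule R p, IsCompl a b ∧ a ≠ ⊥ ∧ b ≠ ⊥ := by
    by_contra! h
    exact hp ⟨inferInstance, fun a b hab => or_iff_not_imp_left.2 (h a b hab)⟩
  have of_ne_top (c : Submodule R p) (hc : c ≠ ⊤) : IsFiniteSumOfIndecomposables R c := by
    refine (ih (c.map p.subtype) ?_).of_linearEquiv
      (c.equivMapOfInjective p.subtype p.injective_subtype)
    simpa using Submodule.map_strictMono_of_injective p.injective_subtype hc.lt_top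
  refine ((of_ne_top a ?_).prod (of_ne_top b ?_)).of_linearEquiv
    (Submodule.prodEquivOfIsCompl a b hab).symm
  · exact fun h => hb (top_disjoint.1 (h ▸ hab.disjoint))
  · exact fun h => ha (disjoint_top.1 (h ▸ hab.disjoint))

end IsFiniteSumOfIndecomposables

end Decomposition

section SelfInjective

theorem exists_isSimpleModule_range {ι : Type*} [Finite ι] {Q : ι → Type*}
    [∀ i, AddCommGroup (Q i)] [∀ i, Module R (Q i)] (e : R ≃ₗ[R] ∀ i, Q i) (X : Type*)
    [AddCommGroup X] [Module R X] [IsArtinian R X] [Nontrivial X] :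
    ∃ (i : ι) (h : Q i →ₗ[R] X), IsSimpleModule R (LinearMap.range h) := by
  classical
  obtain ⟨S, hS, -⟩ := (eq_bot_or_exists_atom_le (⊤ : Submodule R X)).resolve_left top_ne_bot
  obtain ⟨s, hs, hs0⟩ := S.exists_mem_ne_zero_of_ne_bot hS.1
  let f : (∀ i, Q i) →ₗ[R] X := LinearMap.toSpanSingleton R X s ∘ₗ e.symm.toLinearMap
  have f_mem (x) : f x ∈ S := S.smul_mem _ hs
  obtain ⟨i, hi⟩ : ∃ i, f ∘ₗ LinearMap.single R Q i ≠ 0 := by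
    by_contra! h
    have hf : f = 0 := LinearMap.pi_ext' fun i => (h i).trans (LinearMap.zero_comp _).symm
    exact hs0 (by simpa [f] using LinearMap.congr_fun hf (e 1))
  refine ⟨i, f ∘ₗ LinearMap.single R Q i, isSimpleModule_iff_isAtom.2 ?_⟩
  have hle : LinearMap.range (f ∘ₗ LinearMap.single R Q i) ≤ S := by
    rintro _ ⟨x, rfl⟩
    exact f_mem _
  rwa [(hS.le_iff.1 hle).resolve_left (mt LinearMap.range_eq_bot.1 hi)]

theorem nonempty_linearEquiv_of_isSimpleModule_range {P P' : Type*} {X X' : Type v}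
    [Small.{v} R] [AddCommGroup P] [Module R P] [AddCommGroup P'] [Module R P']
    [AddCommGroup X] [Module R X] [AddCommGroup X'] [Module R X']
    [IsLocalRing (Module.End R P)] [IsLocalRing (Module.End R X)]
    [IsLocalRing (Module.End R X')] [Module.Projective R P] (hX : Module.Injective R X)
    (hX' : Module.Injective R X') (e : P ≃ₗ[R] P') (h : P →ₗ[R] X) (h' : P' →ₗ[R] X')
    [IsSimpleModule R (LinearMap.range h)] [IsSimpleModule R (LinearMap.range h')] :
    Nonempty (X ≃ₗ[R] X') := by
  have := IsSimpleModule.nontrivial R (LinearMap.range h)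
  obtain ⟨t⟩ := nonempty_linearEquiv_of_projective h.surjective_rangeRestrict
    (g := h'.rangeRestrict ∘ₗ e.toLinearMap) (h'.surjective_rangeRestrict.comp e.surjective)
  exact nonempty_linearEquiv_of_injective hX hX' (Submodule.injective_subtype _)
    (j := (LinearMap.range h').subtype ∘ₗ t.toLinearMap)
    ((Submodule.injective_subtype _).comp t.injective)

theorem exists_rel_of_rel_imp_rel {ι : Type*} [Finite ι] (r : Setoid ι) {σ : ι → ι}
    (hσ : ∀ i j, r (σ i) (σ j) → r i j) (j : ι) : ∃ i, r (σ i) j := by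
  let τ (c : Quotient r) : Quotient r := Quotient.mk r (σ c.out)
  have hτ : Function.Injective τ := fun c d hcd => by
    rw [← c.out_eq, ← d.out_eq]
    exact Quotient.sound (hσ _ _ (Quotient.exact hcd))
  obtain ⟨c, hc⟩ := Finite.surjective_of_injective hτ (Quotient.mk r j)
  exact ⟨c.out, Quotient.exact hc⟩

theorem IsIndecomposableModule.projective_of_injective [IsArtinianRing R]
    (hR : Module.Injective R R) {I : Type u} [AddCommGroup I] [Module R I] [Module.Finite R I]
    (hI : IsIndecomposableModule R I) (hIi : Module.Injective R I) : Module.Projective R I := by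
  obtain ⟨ι, _, Q, hQ, ⟨e⟩⟩ := IsFiniteSumOfIndecomposables.of_isArtinian (R := R) (X := R)
  have hQR (i : ι) : IsSummandOf R (Q i) R :=
    (isSummandOf_pi_apply (fun i => Q i) i).trans (.of_linearEquiv e.symm)
  have (i : ι) : Module.Finite R (Q i) := (hQR i).finite
  have (i : ι) : Module.Projective R (Q i) := (hQR i).projective
  have hQi (i : ι) : Module.Injective R (Q i) := (hQR i).injective hR
  have (i : ι) : IsLocalRing (Module.End R (Q i)) := (hQ i).isLocalRing_end
  have (i : ι) : Nontrivial (Q i) := (hQ i).1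
  have := hI.isLocalRing_end
  have := hI.1
  -- `σ` is the Nakayama permutation: the head of `Q (σ i)` is a simple submodule of `Q i`.
  choose σ h hσ using fun i => exists_isSimpleModule_range e (Q i)
  obtain ⟨j, g, _⟩ := exists_isSimpleModule_range e I
  let r : Setoid ι :=
    { r := fun i j => Nonempty (Q i ≃ₗ[R] Q j)
      iseqv := ⟨fun i => ⟨.refl R _⟩, fun ⟨e⟩ => ⟨e.symm⟩, fun ⟨e⟩ ⟨e'⟩ => ⟨e.trans e'⟩⟩ }
  obtain ⟨i, ⟨d⟩⟩ := exists_rel_of_rel_imp_rel r (σ := σ) (fun i i' ⟨d⟩ =>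
    nonempty_linearEquiv_of_isSimpleModule_range (hQi i) (hQi i') d (h i) (h i')) j
  obtain ⟨d'⟩ := nonempty_linearEquiv_of_isSimpleModule_range (hQi i) hIi d (h i) g
  exact .of_equiv d'

theorem GeneratesMod.cogeneratesMod [IsArtinianRing R] (hR : Module.Injective R R) {M : Type u}
    [AddCommGroup M] [Module R M] (hM : GeneratesMod R M) : CogeneratesMod R M :=
  fun I hIf hIi hI => hM I hIf (hI.projective_of_injective hR hIi) hI

end SelfInjective

end FiniteLength

section FrobeniusExtension

open CategoryTheory

/-- A Frobenius system for the ring extension `A → B`, `a ↦ a • 1`: a homomorphism of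
`A`-bimodules `trace : B → A` together with dual bases for it. An extension that has a Frobenius
system is called a Frobenius extension. -/
structure FrobeniusSystem (A : Type u) (B : Type v) (ι : Type w) [Ring A] [Ring B] [Module A B]
    [Fintype ι] where
  trace : B →ₗ[A] A
  trace_mul_smul_one (b : B) (a : A) : trace (b * a • 1) = trace b * a
  left : ι → B
  right : ι → B
  sum_left_mul (b : B) : ∑ i, left i * trace (right i * b) • 1 = b
  sum_smul_right (b : B) : ∑ i, trace (b * left i) • right i = b

namespace FrobeniusSystem

section Average

variable {A B ι : Type*} [Ring A] [Ring B] [Module A B] [Fintype ι] (F : FrobeniusSystem A B ι)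
  {Y : Type*} [AddCommGroup Y] [Module A Y] [Module B Y] [IsScalarTower A B Y]
  {Z : Type*} [AddCommGroup Z] [Module A Z] [Module B Z] [IsScalarTower A B Z]

/-- The index of a Frobenius extension: the product in `B` of the Casimir element
`∑ left i ⊗ right i`. -/
def index : B := ∑ i, F.left i * F.right i

theorem sum_left_smul_right_smul_smul (f : Y →ₗ[A] Z) (b : B) (y : Y) :
    ∑ i, F.left i • f (F.right i • b • y) = b • ∑ i, F.left i • f (F.right i • y) := by
  let c (i j : ι) : A := F.trace (F.right i * b * F.left j)
  have right_mul (i : ι) : F.right i * b = ∑ j, c i j • F.right j := (F.sum_smul_right _).symm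
  have mul_left (j : ι) : b * F.left j = ∑ i, F.left i * c i j • 1 := by
    simp_rw [c, mul_assoc, F.sum_left_mul]
  calc ∑ i, F.left i • f (F.right i • b • y)
      = ∑ i, ∑ j, F.left i • c i j • f (F.right j • y) := by
        simp_rw [← mul_smul, right_mul, Finset.sum_smul, map_sum, smul_assoc, map_smul,
          Finset.smul_sum]
    _ = ∑ j, ∑ i, (F.left i * c i j • 1) • f (F.right j • y) := by
        rw [Finset.sum_comm]
        simp_rw [mul_smul, smul_assoc, one_smul]
    _ = b • ∑ i, F.left i • f (F.right i • y) := by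
        simp_rw [← Finset.sum_smul, ← mul_left, mul_smul, Finset.smul_sum]

theorem commute_index [IsScalarTower A B B] (b : B) : Commute F.index b := by
  have h := F.sum_left_smul_right_smul_smul (LinearMap.id (M := B)) b 1
  simpa [index, Finset.sum_mul, mul_assoc, Commute, SemiconjBy] using h

/-- The `B`-linear map obtained from an `A`-linear map by averaging over the Casimir element. -/
noncomputable def average [IsScalarTower A B B] (hF : IsUnit F.index) (f : Y →ₗ[A] Z) :
    Y →ₗ[B] Z where
  toFun y := (↑hF.unit⁻¹ : B) • ∑ i, F.left i • f (F.right i • y)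
  map_add' x y := by simp only [smul_add, map_add, Finset.sum_add_distrib]
  map_smul' b y := by
    have hb : Commute (↑hF.unit⁻¹ : B) b := Commute.units_inv_left (F.commute_index b)
    rw [F.sum_left_smul_right_smul_smul, ← mul_smul, hb.eq, mul_smul, RingHom.id_apply]

theorem inv_index_smul_sum (hF : IsUnit F.index) {X : Type*} [AddCommGroup X] [Module B X]
    (x : X) : (↑hF.unit⁻¹ : B) • ∑ i, F.left i • F.right i • x = x := by
  simp_rw [← mul_smul, ← Finset.sum_smul, ← mul_smul]
  exact (congrArg (· • x) hF.val_inv_mul).trans (one_smul B x)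

variable [IsScalarTower A B B] (hF : IsUnit F.index)

theorem average_comp_eq {X : Type*} [AddCommGroup X] [Module B X] {f : Y →ₗ[A] Z}
    {s : X →ₗ[B] Y} {g : X →ₗ[B] Z} (h : ∀ x, f (s x) = g x) : F.average hF f ∘ₗ s = g := by
  ext x
  simp_rw [LinearMap.comp_apply, average, LinearMap.coe_mk, AddHom.coe_mk, ← map_smul s, h,
    map_smul, F.inv_index_smul_sum hF]

theorem comp_average_eq {W : Type*} [AddCommGroup W] [Module B W] {f : Y →ₗ[A] Z}
    {t : Z →ₗ[B] W} {g : Y →ₗ[B] W} (h : ∀ y, t (f y) = g y) : t ∘ₗ F.average hF f = g := by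
  ext y
  simp_rw [LinearMap.comp_apply, average, LinearMap.coe_mk, AddHom.coe_mk, map_smul, map_sum,
    map_smul, h, map_smul, F.inv_index_smul_sum hF]

end Average

section Transfer

variable {A B ι : Type*} [Ring A] [Ring B] [Module A B] [Fintype ι] (F : FrobeniusSystem A B ι)

include F in
theorem finite : Module.Finite A B :=
  Module.Finite.of_surjective (Fintype.linearCombination A F.right) fun b =>
    ⟨fun i => F.trace (b * F.left i), F.sum_smul_right b⟩

variable [IsScalarTower A B B]

include F in
theorem isSummandOf_pi : IsSummandOf A B (ι → A) :=
  ⟨LinearMap.pi fun i =>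
    { toFun := fun b => F.trace (b * F.left i)
      map_add' := by simp [add_mul]
      map_smul' := by simp [smul_mul_assoc] },
    Fintype.linearCombination A F.right, LinearMap.ext F.sum_smul_right⟩

include F in
theorem projective_restrictScalars (Y : Type*) [AddCommGroup Y] [Module A Y] [Module B Y]
    [IsScalarTower A B Y] [Module.Projective B Y] : Module.Projective A Y := by
  classical
  have : Module.Projective A B := F.isSummandOf_pi.projective
  obtain ⟨s, hs⟩ := Module.projective_def.1 (inferInstance : Module.Projective B Y)
  have : Module.Projective A (Y →₀ B) :=
    Module.Projective.of_equiv (finsuppLequivDFinsupp (ι := Y) (M := B) A).symm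
  exact Module.Projective.of_split (s.restrictScalars A)
    ((Finsupp.linearCombination B id).restrictScalars A) (LinearMap.ext hs)

variable (hF : IsUnit F.index)

include hF in
theorem projective (Y : Type*) [AddCommGroup Y] [Module A Y] [Module B Y]
    [IsScalarTower A B Y] [Module.Projective A Y] : Module.Projective B Y := by
  let q : (Y →₀ B) →ₗ[B] Y := Finsupp.linearCombination B id
  obtain ⟨s, hs⟩ := Module.projective_lifting_property (q.restrictScalars A) LinearMap.id
    (Finsupp.linearCombination_id_surjective B Y)
  exact Module.Projective.of_split (F.average hF s) q
    (F.comp_average_eq hF fun y => LinearMap.congr_fun hs y)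

include hF in
theorem injective {Y : Type w} [Small.{w} A] [AddCommGroup Y] [Module A Y] [Module B Y]
    [IsScalarTower A B Y] (hY : Module.Injective A Y) : Module.Injective B Y := by
  refine Module.Baer.injective fun I f => ?_
  obtain ⟨g, hg⟩ := (Module.Baer.of_injective hY).extension_property
    (I.subtype.restrictScalars A) I.injective_subtype (f.restrictScalars A)
  exact ⟨F.average hF g, fun x hx => LinearMap.congr_fun
    (F.average_comp_eq hF (s := I.subtype) (LinearMap.congr_fun hg)) ⟨x, hx⟩⟩

end Transfer

end FrobeniusSystem

section ProjectiveDimension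

variable {C : Type*} [Category* C] [Abelian C] [EnoughProjectives C] {D : Type*} [Category* D]
  [Abelian D] (T : C ⥤ D) [T.Additive] [Limits.PreservesFiniteLimits T]
  [Limits.PreservesFiniteColimits T] [T.PreservesProjectiveObjects] [T.Faithful]

theorem hasProjectiveDimensionLT_of_map (hT : ∀ X, Projective (T.obj X) → Projective X) (n : ℕ)
    (X : C) (hX : HasProjectiveDimensionLT (T.obj X) n) : HasProjectiveDimensionLT X n := by
  obtain _ | n := n
  · rw [hasProjectiveDimensionLT_zero_iff_isZero, Limits.IsZero.iff_id_eq_zero] at hX ⊢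
    exact T.map_injective (by rw [T.map_id, hX, T.map_zero])
  induction n generalizing X with
  | zero =>
    rw [zero_add, ← projective_iff_hasProjectiveDimensionLT_one] at hX ⊢
    exact hT X hX
  | succ n ih =>
    obtain ⟨P⟩ := EnoughProjectives.presentation X
    let S := ShortComplex.mk _ _ (Limits.kernel.condition P.f)
    have hS : S.ShortExact := { exact := ShortComplex.exact_kernel P.f }
    have hTS : (S.map T).ShortExact := hS.map_of_exact T
    rw [hS.hasProjectiveDimensionLT_X₃_iff n P.projective]
    exact ih _ ((hTS.hasProjectiveDimensionLT_X₃_iff n (T.projective_obj P.p)).1 hX)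

theorem projectiveDimension_le_map (hT : ∀ X, Projective (T.obj X) → Projective X) (X : C) :
    projectiveDimension X ≤ projectiveDimension (T.obj X) :=
  sInf_le_sInf fun _ hd n hn => hasProjectiveDimensionLT_of_map T hT n X (hd n hn)

end ProjectiveDimension

namespace FrobeniusSystem

variable {A B : Type u} {ι : Type*} [Ring A] [Ring B] [Module A B] [Fintype ι]
  [IsScalarTower A B B] (F : FrobeniusSystem A B ι) (hF : IsUnit F.index)

include hF

theorem injective_self (hA : Module.Injective A A) : Module.Injective B B :=
  F.injective hF (F.isSummandOf_pi.injective inferInstance)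

theorem projective_restrictScalars_obj_iff (Y : ModuleCat.{u} B) :
    Projective ((ModuleCat.restrictScalars (RingHom.smulOneHom : A →+* B)).obj Y) ↔
      Projective Y := by
  let Y' := (ModuleCat.restrictScalars (RingHom.smulOneHom : A →+* B)).obj Y
  let : Module B Y' := Y.isModule
  have : IsScalarTower A B Y' := ⟨fun a b y => by rw [← smul_one_mul a b, mul_smul]; rfl⟩
  rw [← IsProjective.iff_projective, ← IsProjective.iff_projective]
  exact ⟨fun _ => F.projective hF Y', fun h =>
    have : Module.Projective B Y' := h
    F.projective_restrictScalars Y'⟩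

theorem globalDim_le : globalDim B ≤ globalDim A := by
  let T : ModuleCat.{u} B ⥤ ModuleCat.{u} A := ModuleCat.restrictScalars RingHom.smulOneHom
  have : T.Additive := inferInstanceAs (ModuleCat.restrictScalars _).Additive
  have : T.Faithful := inferInstanceAs (ModuleCat.restrictScalars _).Faithful
  have : T.PreservesProjectiveObjects :=
    ⟨fun {Y} => (F.projective_restrictScalars_obj_iff hF Y).2⟩
  obtain ⟨_, _⟩ := (T.exact_tfae.out 1 3).1 fun S hS => by
    rw [ShortComplex.ShortExact.moduleCat_exact_iff_function_exact] at hS ⊢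
    exact hS
  refine iSup_le fun Y => le_trans ?_ (le_iSup _ (T.obj Y))
  exact projectiveDimension_le_map T (fun Y => (F.projective_restrictScalars_obj_iff hF Y).1) Y

end FrobeniusSystem

end FrobeniusExtension

section Coinduction

/-- The module coinduced from the `A`-module `M` along a ring extension `A → B`: the `A`-linear
maps `B → M`, on which `B` acts by right translation. -/
def Coinduced (A B M : Type*) [Ring A] [Ring B] [Module A B] [AddCommGroup M] [Module A M] :
    Type _ :=
  B →ₗ[A] M

namespace Coinduced

variable {A B : Type*} [Ring A] [Ring B] [Module A B]
  {M : Type*} [AddCommGroup M] [Module A M]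

instance : AddCommGroup (Coinduced A B M) := inferInstanceAs (AddCommGroup (B →ₗ[A] M))

instance : FunLike (Coinduced A B M) B M := inferInstanceAs (FunLike (B →ₗ[A] M) B M)

instance : LinearMapClass (Coinduced A B M) A B M :=
  inferInstanceAs (LinearMapClass (B →ₗ[A] M) A B M)

@[ext]
theorem ext {x y : Coinduced A B M} (h : ∀ b, x b = y b) : x = y := LinearMap.ext h

@[simp]
theorem add_apply (x y : Coinduced A B M) (b : B) : (x + y) b = x b + y b := rfl

@[simp]
theorem sum_apply {ι : Type*} (s : Finset ι) (x : ι → Coinduced A B M) (b : B) :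
    (∑ i ∈ s, x i) b = ∑ i ∈ s, x i b :=
  LinearMap.sum_apply s x b

instance : Module (Module.End A M) (Coinduced A B M) :=
  inferInstanceAs (Module (Module.End A M) (B →ₗ[A] M))

@[simp]
theorem end_smul_apply (f : Module.End A M) (x : Coinduced A B M) (b : B) :
    (f • x) b = f (x b) := rfl

variable [IsScalarTower A B B]

instance : Module B (Coinduced A B M) where
  smul b x := LinearMap.comp x ((LinearMap.toSpanSingleton B B b).restrictScalars A)
  one_smul x := LinearMap.ext fun c => congrArg x (mul_one c)
  mul_smul b b' x := LinearMap.ext fun c => congrArg x (mul_assoc c b b').symm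
  smul_zero _ := rfl
  smul_add _ _ _ := rfl
  add_smul b b' x := LinearMap.ext fun c =>
    (congrArg x (mul_add c b b')).trans (map_add x (c * b) (c * b'))
  zero_smul x := LinearMap.ext fun c => (congrArg x (mul_zero c)).trans (map_zero x)

@[simp]
theorem smul_apply (b : B) (x : Coinduced A B M) (c : B) : (b • x) c = x (c * b) := rfl

instance : Module A (Coinduced A B M) :=
  Module.compHom (Coinduced A B M) (RingHom.smulOneHom : A →+* B)

instance : IsScalarTower A B (Coinduced A B M) :=
  ⟨fun a b x => by rw [← smul_one_mul a b, mul_smul]; rfl⟩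

instance : SMulCommClass B (Module.End A M) (Coinduced A B M) := ⟨fun _ _ _ => rfl⟩

variable (A B M) in
/-- Evaluation at `1`, the counit of the adjunction between restriction and coinduction. -/
def eval : Coinduced A B M →ₗ[A] M where
  toFun x := x 1
  map_add' _ _ := rfl
  map_smul' a x := by
    rw [← one_smul B x, ← smul_assoc, smul_apply, one_mul, map_smul, one_smul, RingHom.id_apply]

@[simp]
theorem eval_apply (x : Coinduced A B M) : eval A B M x = x 1 := rfl

variable {Y : Type*} [AddCommGroup Y] [Module B Y]

theorem hom_ext {f g : Y →ₗ[B] Coinduced A B M} (h : ∀ y, f y 1 = g y 1) : f = g := by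
  ext y b
  simpa using h (b • y)

variable [Module A Y] [IsScalarTower A B Y]

/-- The `B`-linear map into the coinduced module that corresponds to an `A`-linear map under the
adjunction between restriction and coinduction. -/
def lift (f : Y →ₗ[A] M) : Y →ₗ[B] Coinduced A B M where
  toFun y := f ∘ₗ (LinearMap.toSpanSingleton B Y y).restrictScalars A
  map_add' x y := LinearMap.ext fun b => (congrArg f (smul_add b x y)).trans (map_add f _ _)
  map_smul' c y := LinearMap.ext fun b => congrArg f (mul_smul b c y).symm

@[simp]
theorem lift_apply (f : Y →ₗ[A] M) (y : Y) (b : B) : lift f y b = f (b • y) := rfl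

variable (A B) in
theorem isSummandOf_pi {κ : Type*} (Q : κ → Type*) [∀ j, AddCommGroup (Q j)]
    [∀ j, Module A (Q j)] :
    IsSummandOf B (Coinduced A B (∀ j, Q j)) (∀ j, Coinduced A B (Q j)) :=
  ⟨LinearMap.pi fun j => lift (LinearMap.proj j ∘ₗ eval A B (∀ j, Q j)),
    lift (LinearMap.pi fun j => eval A B (Q j) ∘ₗ LinearMap.proj j),
    hom_ext fun x => funext fun j => by simp⟩

end Coinduced

theorem IsSummandOf.coinduced {A M N : Type*} [Ring A] [AddCommGroup M] [Module A M]
    [AddCommGroup N] [Module A N] (h : IsSummandOf A M N) (B : Type*) [Ring B] [Module A B]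
    [IsScalarTower A B B] : IsSummandOf B (Coinduced A B M) (Coinduced A B N) := by
  obtain ⟨i, p, hp⟩ := h
  refine ⟨Coinduced.lift (i ∘ₗ Coinduced.eval A B M), Coinduced.lift (p ∘ₗ Coinduced.eval A B N),
    Coinduced.hom_ext fun x => ?_⟩
  simpa using LinearMap.congr_fun hp (x 1)

namespace FrobeniusSystem

variable {A B : Type*} [Ring A] [Ring B] [Module A B] [IsScalarTower A B B]
  {ι : Type*} [Fintype ι] (F : FrobeniusSystem A B ι)

include F in
theorem isSummandOf_coinduced (hF : IsUnit F.index) (Y : Type*) [AddCommGroup Y] [Module A Y]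
    [Module B Y] [IsScalarTower A B Y] : IsSummandOf B Y (Coinduced A B Y) :=
  ⟨Coinduced.lift LinearMap.id, F.average hF (Coinduced.eval A B Y),
    F.average_comp_eq hF (g := LinearMap.id) fun y => one_smul B y⟩

variable {M : Type*} [AddCommGroup M] [Module A M] {Y : Type*} [AddCommGroup Y] [Module B Y]

/-- The unit of the adjunction between coinduction and restriction along a Frobenius
extension. -/
def incl : M →ₗ[A] Coinduced A B M where
  toFun m := F.trace.smulRight m
  map_add' m m' := LinearMap.ext fun b => smul_add (F.trace b) m m'
  map_smul' a m := LinearMap.ext fun b => by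
    change F.trace b • a • m = F.trace (b * a • 1) • m
    rw [F.trace_mul_smul_one, mul_smul]

@[simp]
theorem incl_apply (m : M) (b : B) : F.incl m b = F.trace b • m := rfl

theorem end_smul_incl (f : Module.End A M) (m : M) : f • F.incl m = F.incl (f m) :=
  Coinduced.ext fun b => map_smul f (F.trace b) m

theorem sum_left_smul_incl (x : Coinduced A B M) :
    ∑ i, F.left i • F.incl (x (F.right i)) = x :=
  Coinduced.ext fun b => by
    simpa [map_sum] using congrArg x (F.sum_smul_right b)

theorem hom_ext_incl {f g : Coinduced A B M →ₗ[B] Y} (h : ∀ m, f (F.incl m) = g (F.incl m)) :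
    f = g := by
  ext x
  rw [← F.sum_left_smul_incl x]
  simp only [map_sum, map_smul, h]

variable [Module A Y] [IsScalarTower A B Y]

/-- The `B`-linear map out of the coinduced module that corresponds to an `A`-linear map under the
adjunction between coinduction and restriction along a Frobenius extension. -/
def extend (f : M →ₗ[A] Y) : Coinduced A B M →ₗ[B] Y where
  toFun x := ∑ i, F.left i • f (x (F.right i))
  map_add' x y := by simp only [Coinduced.add_apply, map_add, smul_add, Finset.sum_add_distrib]
  map_smul' b x := by
    have h := F.sum_left_smul_right_smul_smul (f ∘ₗ (x : B →ₗ[A] M)) b 1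
    simp only [smul_eq_mul, mul_one] at h
    exact h

theorem extend_apply (f : M →ₗ[A] Y) (x : Coinduced A B M) :
    F.extend f x = ∑ i, F.left i • f (x (F.right i)) := rfl

theorem extend_incl (f : M →ₗ[A] Y) (m : M) : F.extend f (F.incl m) = f m := by
  have h : ∑ i, F.left i * F.trace (F.right i) • 1 = 1 := by simpa using F.sum_left_mul 1
  calc F.extend f (F.incl m) = (∑ i, F.left i * F.trace (F.right i) • 1) • f m := by
        simp only [extend_apply, incl_apply, map_smul, Finset.sum_smul, mul_smul, smul_assoc,
          one_smul]
    _ = f m := by rw [h, one_smul]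

variable {κ : Type*} [Fintype κ] [DecidableEq κ] {i : Coinduced A B M →ₗ[A] κ → M}
  {p : (κ → M) →ₗ[A] Coinduced A B M}

/-- The trace of the extension `End_A(M) → End_B(Coinduced A B M)`. -/
def traceEnd : Module.End B (Coinduced A B M) →ₗ[Module.End A M] Module.End A M where
  toFun φ := Coinduced.eval A B M ∘ₗ φ.restrictScalars A ∘ₗ F.incl
  map_add' _ _ := rfl
  map_smul' _ _ := rfl

@[simp]
theorem traceEnd_apply (φ : Module.End B (Coinduced A B M)) (m : M) :
    F.traceEnd φ m = φ (F.incl m) 1 := rfl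

/-- If the coinduced module is a summand of a finite power of `M`, then coinduction makes its
endomorphism ring a Frobenius extension of the endomorphism ring of `M`. -/
def coinducedEnd (h : p ∘ₗ i = LinearMap.id) :
    FrobeniusSystem (Module.End A M) (Module.End B (Coinduced A B M)) κ where
  trace := F.traceEnd
  trace_mul_smul_one φ f := LinearMap.ext fun m =>
    congrArg (fun x => φ x 1) (F.end_smul_incl f m)
  left j := F.extend (p ∘ₗ LinearMap.single A (fun _ => M) j)
  right j := Coinduced.lift (LinearMap.proj j ∘ₗ i)
  sum_left_mul φ := F.hom_ext_incl fun m => by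
    simpa [F.end_smul_incl, F.extend_incl] using
      sum_apply_single_of_comp_eq_id h (φ (F.incl m))
  sum_smul_right φ := Coinduced.hom_ext fun x => by
    calc (∑ j, F.traceEnd (φ * F.extend (p ∘ₗ LinearMap.single A (fun _ => M) j)) •
          Coinduced.lift (LinearMap.proj j ∘ₗ i)) x (1 : B)
        = φ (∑ j, p (Pi.single j (i x j))) (1 : B) := by
          rw [map_sum φ]
          simp [F.extend_incl]
      _ = φ x (1 : B) := by rw [sum_apply_single_of_comp_eq_id h]

theorem index_coinducedEnd_apply (h : p ∘ₗ i = LinearMap.id) (x : Coinduced A B M) :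
    (F.coinducedEnd h).index x = F.index • x := by
  have hp (k : ι) := sum_apply_single_of_comp_eq_id h (F.right k • x)
  simp only [index, coinducedEnd, LinearMap.sum_apply, Module.End.mul_apply, extend_apply]
  rw [Finset.sum_comm]
  simp [← Finset.smul_sum, hp, Finset.sum_smul, mul_smul]

theorem isUnit_index_coinducedEnd (hF : IsUnit F.index) (h : p ∘ₗ i = LinearMap.id) :
    IsUnit (F.coinducedEnd h).index := by
  rw [Module.End.isUnit_iff]
  convert hF.smul_bijective (β := Coinduced A B M) using 1
  exact funext (F.index_coinducedEnd_apply h)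

end FrobeniusSystem

end Coinduction

section RepresentationDimension

variable {A B : Type u} [Ring A] [Ring B] [Module A B] [IsScalarTower A B B]
  {M : Type u} [AddCommGroup M] [Module A M] {ι : Type*} [Fintype ι] (F : FrobeniusSystem A B ι)
  (hF : IsUnit F.index)

include hF in
theorem FrobeniusSystem.globalDim_end_coinduced_le (hadd : MemAdd A M (Coinduced A B M)) :
    globalDim (Module.End B (Coinduced A B M)) ≤ globalDim (Module.End A M) := by
  obtain ⟨n, i, p, h⟩ := hadd
  exact (F.coinducedEnd h).globalDim_le (F.isUnit_index_coinducedEnd hF h)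

variable [IsArtinianRing A]

include F

theorem FrobeniusSystem.isArtinianRing : IsArtinianRing B :=
  have := F.finite
  isArtinian_of_tower A inferInstance

include hF

theorem GeneratesMod.coinduced (hM : GeneratesMod A M) : GeneratesMod B (Coinduced A B M) := by
  intro P _ _ hP
  have := F.isArtinianRing
  have := hP.isLocalRing_end
  obtain ⟨κ, _, Q, hQ, ⟨e⟩⟩ := IsFiniteSumOfIndecomposables.of_isArtinian (R := A) (X := A)
  have hQA (j : κ) : IsSummandOf A (Q j) A :=
    (isSummandOf_pi_apply (fun j => Q j) j).trans (.of_linearEquiv e.symm)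
  obtain ⟨n, f, s, -, -, hs⟩ := Module.Finite.exists_comp_eq_id_of_projective B P
  obtain ⟨-, hPB⟩ := exists_isSummandOf_of_pi ⟨s, f, hs⟩
  obtain ⟨-, hPA⟩ := exists_isSummandOf_of_pi <| hPB.trans <|
    (F.isSummandOf_coinduced hF B).trans <| (F.isSummandOf_pi.coinduced B).trans <|
      Coinduced.isSummandOf_pi A B fun _ => A
  obtain ⟨j, hPQ⟩ := exists_isSummandOf_of_pi <| hPA.trans <|
    ((IsSummandOf.of_linearEquiv e).coinduced B).trans <| Coinduced.isSummandOf_pi A B fun j => Q j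
  have hQM : IsSummandOf A (Q j) M := hM (Q j) (hQA j).finite (hQA j).projective (hQ j)
  exact hPQ.trans (hQM.coinduced B)

theorem FrobeniusSystem.repDim_le (hA : Module.Injective A A) [Module.Finite A M]
    (hM : GeneratesMod A M) (hadd : MemAdd A M (Coinduced A B M)) :
    repDim B ≤ globalDim (Module.End A M) := by
  have := F.isArtinianRing
  have : Module.Finite A (Coinduced A B M) := hadd.choose_spec.finite
  have hgen := hM.coinduced F hF
  have hcogen := hgen.cogeneratesMod (F.injective_self hF hA)
  calc repDim B ≤ globalDim (Module.End B (Coinduced A B M)) :=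
        sInf_le ⟨ModuleCat.of B (Coinduced A B M), .of_restrictScalars_finite A B _, hgen, hcogen,
          rfl⟩
    _ ≤ globalDim (Module.End A M) := F.globalDim_end_coinduced_le hF hadd

end RepresentationDimension

section SkewGroupAlgebra

open SkewMonoidAlgebra

variable (A G : Type*) [Ring A]

theorem sum_coeff_smul_single [Fintype G] (b : SkewMonoidAlgebra A G) :
    ∑ g, b.coeff g • single g (1 : A) = b :=
  basisSingleOne.sum_repr b

variable [Group G] [MulSemiringAction G A]

theorem single_one_mul_smul_one (g : G) (a : A) :
    single g (1 : A) * a • (1 : SkewMonoidAlgebra A G) = (g • a) • single g 1 := by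
  simp [one_def, smul_single, single_mul_single, -single_one_one]

/-- The Frobenius system of the skew group algebra over its coefficients: the coefficient of `1`
is a trace, with dual bases `g⁻¹` and `g`. -/
noncomputable def skewGroupAlgebraFrobeniusSystem [Fintype G] :
    FrobeniusSystem A (SkewMonoidAlgebra A G) G where
  trace :=
    { toFun := fun b => b.coeff 1
      map_add' := fun b c => by rw [coeff_add, Finsupp.add_apply]
      map_smul' := fun a b => by rw [coeff_smul, Finsupp.smul_apply, RingHom.id_apply] }
  trace_mul_smul_one b a := by simp [one_def, smul_single, -single_one_one]
  left g := single g⁻¹ 1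
  right g := single g 1
  sum_left_mul b := by
    rw [← Equiv.sum_comp (Equiv.inv G)]
    simpa [single_one_mul_smul_one] using sum_coeff_smul_single A G b
  sum_smul_right b := by
    simpa using sum_coeff_smul_single A G b

theorem index_skewGroupAlgebraFrobeniusSystem [Fintype G] :
    (skewGroupAlgebraFrobeniusSystem A G).index = Nat.card G := by
  simp [FrobeniusSystem.index, skewGroupAlgebraFrobeniusSystem, single_mul_single]

theorem isUnit_index_skewGroupAlgebraFrobeniusSystem [Fintype G] (hG : IsUnit (Nat.card G : A)) :
    IsUnit (skewGroupAlgebraFrobeniusSystem A G).index := by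
  rw [index_skewGroupAlgebraFrobeniusSystem]
  simpa using hG.map (singleOneRingHom (k := A) (G := G))

variable (M : Type*) [AddCommGroup M] [Module A M]

/-- A map out of the skew group algebra is determined by its values on the group, which
identifies the coinduced module with the sum of the twists. -/
noncomputable def coinducedEquivPiTwisted : Coinduced A (SkewMonoidAlgebra A G) M ≃ₗ[A]
    ∀ g : G, TwistedModule g M where
  toFun x g := x (single g 1)
  map_add' _ _ := rfl
  map_smul' a x := funext fun g =>
    (congrArg x (single_one_mul_smul_one A G g a)).trans (map_smul x (g • a) (single g 1))
  invFun m := (basisSingleOne (k := A) (G := G)).constr ℕ m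
  left_inv x := (basisSingleOne (k := A) (G := G)).ext fun g =>
    (basisSingleOne (k := A) (G := G)).constr_basis ℕ (fun g => x (single g 1)) g
  right_inv m := funext fun g => (basisSingleOne (k := A) (G := G)).constr_basis ℕ (M' := M) m g

end SkewGroupAlgebra

theorem theorem2p4_general {Λ : Type u} [Ring Λ] [IsArtinianRing Λ] (hΛ : Module.Injective Λ Λ)
    {G : Type u} [Group G] [Finite G] [MulSemiringAction G Λ] (hG : IsUnit (Nat.card G : Λ))
    (M : Type u) [AddCommGroup M] [Module Λ M] [Module.Finite Λ M]
    (hM : GeneratesMod Λ M) (hadd : MemAdd Λ M (⨁ g : G, TwistedModule g M)) :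
    repDim (SkewMonoidAlgebra Λ G) ≤ globalDim (Module.End Λ M) := by
  classical
  have := Fintype.ofFinite G
  obtain ⟨n, hn⟩ := hadd
  have e : Coinduced Λ (SkewMonoidAlgebra Λ G) M ≃ₗ[Λ] ⨁ g : G, TwistedModule g M :=
    coinducedEquivPiTwisted Λ G M ≪≫ₗ
      (DirectSum.linearEquivFunOnFintype Λ G fun g => TwistedModule g M).symm
  exact (skewGroupAlgebraFrobeniusSystem Λ G).repDim_le
    (isUnit_index_skewGroupAlgebraFrobeniusSystem Λ G hG) hΛ hM
    ⟨n, (IsSummandOf.of_linearEquiv e).trans hn⟩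

/-- The action of `G` on `Λ` by `k`-algebra automorphisms is given by `MulSemiringAction G Λ` and
`SMulCommClass G k Λ`; `SkewMonoidAlgebra Λ G` is the skew group algebra `Λ[G]`, with
multiplication `(a g) (b h) = a g(b) gh`. -/
theorem theorem2p4 {k : Type v} [Field k] {Λ : Type u} [Ring Λ] [Algebra k Λ]
    [Module.Finite k Λ] (hΛ : Module.Injective Λ Λ)
    {G : Type u} [Group G] [Finite G] [MulSemiringAction G Λ] [SMulCommClass G k Λ]
    (hG : IsUnit (Nat.card G : k))
    (M : Type u) [AddCommGroup M] [Module Λ M] [Module.Finite Λ M]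
    (hM : GeneratesMod Λ M) (hadd : MemAdd Λ M (⨁ g : G, TwistedModule g M)) :
    repDim (SkewMonoidAlgebra Λ G) ≤ globalDim (Module.End Λ M) := by
  have : IsArtinianRing Λ := isArtinian_of_tower k inferInstance
  exact theorem2p4_general hΛ (by simpa using hG.map (algebraMap k Λ)) M hM hadd
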